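/- Let $R$ be a real $m\times n$ matrix, $\|x\|_R:=\|Rx\|_2$ on $\mathbb R^n$, so $\ker\|\cdot\|_R=\ker R$. For an $n\times n$ matrix $A$ let $\|A\|_R:=\sup\{\|Av\|_R : v\perp\ker R,\ \|v\|_R\le 1\}$, with induced matrix measure $\mu_R(A):=\lim_{h\to0^+}(\|I+hA\|_R-1)/h$ (finite whenever $R\neq 0$). Let $f:\mathbb R^n\to\mathbb R^n$ be continuously differentiable and let $\mathcal D\subseteq\mathbb R^n$ be convex. Suppose that $Df(x)\ker R\subseteq\ker R$ for all $x\in\mathcal D$, and that the autonomous system $\dot x=f(x)$ is semi-contracting on $\mathcal D$ with rate $c>0$, i.e. $\mu_R(Df(x))\le -c$ for all $x\in\mathcal D$. Let $x_c\in\mathcal D$, $r_{\mathrm{res}}:=\|f(x_c)\|_R$, and for a radius $\bar r\ge r_{\mathrm{res}}/c$ let $$\mathcal T_{\bar r}(x_c):=\Bigl\{x : \inf_{v\in\ker R}\|x-(x_c+v)\|_R\le\bar r\Bigr\}.$$ If $\mathcal T_{\bar r}(x_c)\subseteq\mathcal D$, then: (i) $\mathcal T_{\bar r}(x_c)$ is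 forward-invariant: every solution on an interval $[0,T)$ that starts in it stays in it; (ii) $\mathcal T_{\bar r}(x_c)$ contains an equilibrium manifold $x^*+\ker R$ of the transverse dynamics, i.e. $\|f(y)\|_R=0$ for every $y\in x^*+\ker R$, and $\inf_{v\in\ker R}\|x_c-(x^*+v)\|_R\le r_{\mathrm{res}}/c$; (iii) it is the unique one in $\mathcal D$: if $y\in\mathcal D$ and $\|f(y)\|_R=0$, then $y+\ker R=x^*+\ker R$. The same holds, with neither the smoothness of $f$ nor the invariance of $\ker R$ assumed, for the droop-controlled microgrid with $N$ buses, state $x=(\theta,V)\in\mathbb R^{2N}$ and dynamics $$\dot\theta_i=\omega_{\mathrm{nom}}-m_{p,i}(P_i-P_i^{\mathrm{ref}}),\qquad \tau_{v,i}\dot V_i=V_{\mathrm{nom},i}-V_i-n_{q,i}(Q_i-Q_i^{\mathrm{ref}}),$$ with constants $m_{p,i}>0$, $n_{q,i}\ge0$, $\tau_{v,i}>0$ and constant references, where, for real matrices $G,B$, $$P_i=V_i^2G_{ii}+V_i\sum_{k\ne i}V_k(G_{ik}\cos\theta_{ik}+B_{ik}\sin\theta_{ik}),\quad Q_i=-V_i^2B_{ii}+V_i\sum_{k\ne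 i}V_k(G_{ik}\sin\theta_{ik}-B_{ik}\cos\theta_{ik}),\quad \theta_{ik}=\theta_i-\theta_k,$$ and $R=\mathrm{blkdiag}(R_\theta,I_N)$, where the rows of $R_\theta\in\mathbb R^{(N-1)\times N}$ are orthonormal and span $\{\mathbf 1_N\}^\perp$; in this case, moreover, a solution on $[0,\infty)$ starts at every point of the tube. -/

import Mathlib

open Filter Topology

noncomputable section

/-! ### Seminorms, matrix measures, semi-contraction -/

/-- The seminorm `‖x‖_R = ‖R x‖₂` on Euclidean space given by a real matrix `R`. -/
def weightedSeminorm {ι κ : Type*} [Fintype ι] [DecidableEq ι] [Fintype κ]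
    (R : Matrix κ ι ℝ) : Seminorm ℝ (EuclideanSpace ℝ ι) :=
  (normSeminorm ℝ (EuclideanSpace ℝ κ)).comp (Matrix.toEuclideanLin R)

/-- The operator seminorm induced by `p`: the supremum of `p (A v)` over the vectors `v` orthogonal
to the kernel of `p` with `p v ≤ 1`. -/
def inducedSeminorm {ι : Type*} [Fintype ι] (p : Seminorm ℝ (EuclideanSpace ℝ ι))
    (A : EuclideanSpace ℝ ι →L[ℝ] EuclideanSpace ℝ ι) : ℝ :=
  sSup {a : ℝ | ∃ v : EuclideanSpace ℝ ι,
    (∀ w, p w = 0 → inner ℝ v w = 0) ∧ p v ≤ 1 ∧ a = p (A v)}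

/-- `m` is the matrix measure (logarithmic seminorm) of `A` induced by `p`, that is
`m = lim_{h → 0⁺} (‖I + h A‖_p - 1) / h`.  The limit exists for every `A` as soon as `p ≠ 0`. -/
def HasMatrixMeasure {ι : Type*} [Fintype ι] (p : Seminorm ℝ (EuclideanSpace ℝ ι))
    (A : EuclideanSpace ℝ ι →L[ℝ] EuclideanSpace ℝ ι) (m : ℝ) : Prop :=
  Tendsto (fun h : ℝ =>
      (inducedSeminorm p (ContinuousLinearMap.id ℝ (EuclideanSpace ℝ ι) + h • A) - 1) / h)
    (𝓝[>] 0) (𝓝 m)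

/-- `ẋ = f x` is semi-contracting on `D` with rate `c`: the matrix measure of the Jacobian is at
most `-c` at every point of `D`. -/
def SemiContractingOn {ι : Type*} [Fintype ι] (p : Seminorm ℝ (EuclideanSpace ℝ ι))
    (f : EuclideanSpace ℝ ι → EuclideanSpace ℝ ι) (D : Set (EuclideanSpace ℝ ι)) (c : ℝ) : Prop :=
  ∀ x ∈ D, ∃ m : ℝ, HasMatrixMeasure p (fderiv ℝ f x) m ∧ m ≤ -c

/-- The kernel of `p` is infinitesimally invariant on `D`: the Jacobian maps it to itself. -/
def KernelInvariantOn {ι : Type*} [Fintype ι] (p : Seminorm ℝ (EuclideanSpace ℝ ι))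
    (f : EuclideanSpace ℝ ι → EuclideanSpace ℝ ι) (D : Set (EuclideanSpace ℝ ι)) : Prop :=
  ∀ x ∈ D, ∀ v, p v = 0 → p (fderiv ℝ f x v) = 0

/-! ### Tubes, forward invariance, equilibrium manifolds -/

/-- The affine manifold `x + ker p`. -/
def kerCoset {ι : Type*} [Fintype ι] (p : Seminorm ℝ (EuclideanSpace ℝ ι))
    (x : EuclideanSpace ℝ ι) : Set (EuclideanSpace ℝ ι) :=
  {y | ∃ v, p v = 0 ∧ y = x + v}

/-- The `p`-distance of `x` from the affine manifold `y + ker p`. -/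
def infDistCoset {ι : Type*} [Fintype ι] (p : Seminorm ℝ (EuclideanSpace ℝ ι))
    (x y : EuclideanSpace ℝ ι) : ℝ :=
  ⨅ v : {v : EuclideanSpace ℝ ι // p v = 0}, p (x - (y + v))

/-- The tube of `p`-radius `r` around `xc + ker p`. -/
def tube {ι : Type*} [Fintype ι] (p : Seminorm ℝ (EuclideanSpace ℝ ι))
    (xc : EuclideanSpace ℝ ι) (r : ℝ) : Set (EuclideanSpace ℝ ι) :=
  {x | infDistCoset p x xc ≤ r}

/-- `S` is forward-invariant for `ẋ = f x`: a solution on an interval `[0, T)` that starts in `S`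
stays in `S`. -/
def ForwardInvariant {ι : Type*} [Fintype ι]
    (f : EuclideanSpace ℝ ι → EuclideanSpace ℝ ι) (S : Set (EuclideanSpace ℝ ι)) : Prop :=
  ∀ (T : ℝ) (x : ℝ → EuclideanSpace ℝ ι),
    IsIntegralCurveOn x (fun _ => f) (Set.Ico 0 T) → x 0 ∈ S → ∀ t ∈ Set.Ico 0 T, x t ∈ S

/-- `xs + ker p` is an equilibrium manifold of `ẋ = f x` transverse to the kernel of `p`: the
vector field has zero `p`-seminorm at each of its points. -/
def IsEquilibriumManifold {ι : Type*} [Fintype ι] (p : Seminorm ℝ (EuclideanSpace ℝ ι))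
    (f : EuclideanSpace ℝ ι → EuclideanSpace ℝ ι) (xs : EuclideanSpace ℝ ι) : Prop :=
  ∀ y ∈ kerCoset p xs, p (f y) = 0

/-! ### The droop-controlled microgrid -/

/-- Data of a droop-controlled microgrid with `N` buses and constant power references. -/
structure DroopMicrogrid (N : ℕ) where
  /-- conductance matrix -/
  G : Matrix (Fin N) (Fin N) ℝ
  /-- susceptance matrix -/
  B : Matrix (Fin N) (Fin N) ℝ
  /-- nominal frequency -/
  omegaNom : ℝ
  /-- nominal voltages -/
  VNom : Fin N → ℝ
  /-- active power references -/
  PRef : Fin N → ℝ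
  /-- reactive power references -/
  QRef : Fin N → ℝ
  /-- active power droop coefficients -/
  mp : Fin N → ℝ
  /-- reactive power droop coefficients -/
  nq : Fin N → ℝ
  /-- time constants of the voltage control loops -/
  tau : Fin N → ℝ
  mp_pos : ∀ i, 0 < mp i
  nq_nonneg : ∀ i, 0 ≤ nq i
  tau_pos : ∀ i, 0 < tau i

/-- The state `x = (θ, V)`: the coordinate `inl i` is the angle `θ i`, and `inr i` the voltage
magnitude `V i`. -/
abbrev GridState (N : ℕ) : Type := EuclideanSpace ℝ (Fin N ⊕ Fin N)

namespace DroopMicrogrid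

variable {N : ℕ} (M : DroopMicrogrid N)

/-- Active power injection at bus `i`. -/
def activePower (x : GridState N) (i : Fin N) : ℝ :=
  x (.inr i) ^ 2 * M.G i i + x (.inr i) * ∑ k ∈ Finset.univ.erase i, x (.inr k) *
    (M.G i k * Real.cos (x (.inl i) - x (.inl k)) + M.B i k * Real.sin (x (.inl i) - x (.inl k)))

/-- Reactive power injection at bus `i`. -/
def reactivePower (x : GridState N) (i : Fin N) : ℝ :=
  -(x (.inr i) ^ 2 * M.B i i) + x (.inr i) * ∑ k ∈ Finset.univ.erase i, x (.inr k) *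
    (M.G i k * Real.sin (x (.inl i) - x (.inl k)) - M.B i k * Real.cos (x (.inl i) - x (.inl k)))

/-- The vector field of the droop dynamics
`θ̇ᵢ = ω_nom - m_{p,i} (Pᵢ - Pᵢ^ref)`, `τᵢ V̇ᵢ = V_{nom,i} - Vᵢ - n_{q,i} (Qᵢ - Qᵢ^ref)`. -/
def vectorField (x : GridState N) : GridState N :=
  WithLp.toLp 2 (Sum.elim
    (fun i => M.omegaNom - M.mp i * (M.activePower x i - M.PRef i))
    (fun i => (M.VNom i - x (.inr i) - M.nq i * (M.reactivePower x i - M.QRef i)) / M.tau i))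

end DroopMicrogrid

/-- The rows of `Rθ` are orthonormal and span the orthogonal complement of the all-one vector. -/
def IsAngleProjection {N : ℕ} (Rθ : Matrix (Fin (N - 1)) (Fin N) ℝ) : Prop :=
  Orthonormal ℝ (fun a => (WithLp.toLp 2 (Rθ a) : EuclideanSpace ℝ (Fin N))) ∧
  Submodule.span ℝ (Set.range fun a => (WithLp.toLp 2 (Rθ a) : EuclideanSpace ℝ (Fin N))) =
    (Submodule.span ℝ {(WithLp.toLp 2 (fun _ => 1) : EuclideanSpace ℝ (Fin N))})ᗮ

/-- The projection matrix `R = blkdiag(Rθ, I)` on states `(θ, V)`. -/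
def gridProjection {N : ℕ} (Rθ : Matrix (Fin (N - 1)) (Fin N) ℝ) :
    Matrix (Fin (N - 1) ⊕ Fin N) (Fin N ⊕ Fin N) ℝ :=
  Matrix.fromBlocks Rθ 0 0 1

end

/-! Factor the seminorm as `‖L x‖`, where `L` is `R` corestricted to its range, with a linear
section `S`. Testing the quotients that define the matrix measure on vectors orthogonal to the
kernel bounds the symmetric part of the transverse Jacobian by `-c`; kernel invariance extends the
bound to all vectors (`inner_map_le_of_hasMatrixMeasure`). Integrated along segments of the convex
domain it becomes a one-sided Lipschitz bound for `L ∘ f` (`inner_map_sub_le_of_fderiv_le`), and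
kernel invariance makes `L ∘ f` constant along the kernel inside the domain
(`map_eq_of_ker_invariant`).

Uniqueness is immediate from the bound. Comparing a boundary point of the tube with the centre,
Cauchy-Schwarz and `r ≥ r_res / c` show that the field does not point outwards there
(`inner_map_nonpos_of_boundary`); a Grönwall-type comparison turns this into invariance. For
existence, `u ↦ L (f (xc + S u))` is strongly dissipative on the ball of radius `r_res / c`, and a
projected Euler step is a contraction whose fixed point is a zero
(`exists_zero_of_strongly_dissipative`).

The droop field is smooth and sees only voltages and angle differences, so it is invariant under
translations along the kernel. Hence on the tube it agrees with a bounded, globally Lipschitz field,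
whose global solutions never leave the tube. -/

/-! ### Metric projection onto a ball. -/

section RadialRetraction

variable {V : Type*} [NormedAddCommGroup V] [InnerProductSpace ℝ V]

/-- The metric projection of an inner product space onto the closed ball of radius `r` around `0`,
for `0 ≤ r`. -/
noncomputable def radialRetraction (r : ℝ) (z : V) : V := (r / max r ‖z‖) • z

lemma radialRetraction_of_norm_le {r : ℝ} {z : V} (hz : ‖z‖ ≤ r) : radialRetraction r z = z := by
  rw [radialRetraction, max_eq_left hz]
  rcases eq_or_ne r 0 with rfl | h
  · rw [norm_le_zero_iff.1 hz, smul_zero]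
  · rw [div_self h, one_smul]

lemma radialRetraction_of_le_norm {r : ℝ} {z : V} (hz : r ≤ ‖z‖) :
    radialRetraction r z = (r / ‖z‖) • z := by
  rw [radialRetraction, max_eq_right hz]

lemma norm_radialRetraction_le {r : ℝ} (hr : 0 ≤ r) (z : V) : ‖radialRetraction r z‖ ≤ r := by
  rcases le_total ‖z‖ r with h | h
  · rwa [radialRetraction_of_norm_le h]
  · rw [radialRetraction_of_le_norm h, norm_smul, Real.norm_of_nonneg (by positivity)]
    rcases eq_or_ne ‖z‖ 0 with h0 | h0
    · rwa [h0, mul_zero]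
    · rw [div_mul_cancel₀ _ h0]

/-- The variational inequality of the metric projection, from which nonexpansiveness follows by
adding two instances. -/
lemma inner_sub_radialRetraction_nonpos {r : ℝ} (hr : 0 ≤ r) (z : V) {w : V} (hw : ‖w‖ ≤ r) :
    inner ℝ (z - radialRetraction r z) (w - radialRetraction r z) ≤ 0 := by
  rcases le_or_gt ‖z‖ r with h | h
  · simp [radialRetraction_of_norm_le h]
  · have hz : 0 < ‖z‖ := hr.trans_lt h
    rw [radialRetraction_of_le_norm h.le]
    have h1 : z - (r / ‖z‖) • z = (1 - r / ‖z‖) • z := by rw [sub_smul, one_smul]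
    rw [h1, real_inner_smul_left, inner_sub_right, real_inner_smul_right,
      real_inner_self_eq_norm_sq]
    have h2 : r / ‖z‖ * ‖z‖ ^ 2 = r * ‖z‖ := by field_simp
    have h3 : 0 ≤ 1 - r / ‖z‖ := by
      rw [sub_nonneg, div_le_one hz]; exact h.le
    have h4 : inner ℝ z w ≤ r * ‖z‖ :=
      (real_inner_le_norm z w).trans (by nlinarith)
    rw [h2]
    exact mul_nonpos_of_nonneg_of_nonpos h3 (by linarith)

lemma norm_radialRetraction_sub_le {r : ℝ} (hr : 0 ≤ r) (z w : V) :
    ‖radialRetraction r z - radialRetraction r w‖ ≤ ‖z - w‖ := by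
  have h1 := inner_sub_radialRetraction_nonpos hr z (norm_radialRetraction_le hr w)
  have h2 := inner_sub_radialRetraction_nonpos hr w (norm_radialRetraction_le hr z)
  set a := radialRetraction r z
  set b := radialRetraction r w
  have h3 : ‖a - b‖ ^ 2 ≤ ‖z - w‖ * ‖a - b‖ := by
    refine le_trans ?_ (real_inner_le_norm (z - w) (a - b))
    rw [← real_inner_self_eq_norm_sq]
    have : inner ℝ (z - w) (a - b) - inner ℝ (a - b) (a - b)
        = -inner ℝ (z - a) (b - a) - inner ℝ (w - b) (a - b) := by
      simp only [inner_sub_left, inner_sub_right]; ring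
    linarith
  by_contra! h
  have := (norm_nonneg (z - w)).trans_lt h
  nlinarith

end RadialRetraction

/-! ### Zeros of strongly dissipative maps. -/

section OneSidedLipschitz

variable {V : Type*} [NormedAddCommGroup V] [InnerProductSpace ℝ V]

/-- A strongly dissipative Lipschitz map on a closed ball around `0` whose radius is at least
`‖g 0‖ / c` has a zero in the ball. -/
lemma exists_zero_of_strongly_dissipative [CompleteSpace V] {g : V → V} {r c K : ℝ} (hc : 0 < c)
    (hr : 0 ≤ r)
    (hlip : ∀ u w, ‖u‖ ≤ r → ‖w‖ ≤ r → ‖g u - g w‖ ≤ K * ‖u - w‖)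
    (hg : ∀ u w, ‖u‖ ≤ r → ‖w‖ ≤ r → inner ℝ (u - w) (g u - g w) ≤ -c * ‖u - w‖ ^ 2)
    (h0 : ‖g 0‖ ≤ c * r) : ∃ u, ‖u‖ ≤ r ∧ g u = 0 := by
  rcases hr.eq_or_lt with rfl | hr'
  · exact ⟨0, by simp, norm_le_zero_iff.1 (by simpa using h0)⟩
  -- A Lipschitz constant that is positive and at least `c`, whatever the sign of `K`; the step `h =
  -- c / M ^ 2` then minimises `1 - 2 h c + h ^ 2 M ^ 2`, with minimum `q`.
  set M : ℝ := c + |K| with hM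
  have hMc : c ≤ M := le_add_of_nonneg_right (abs_nonneg K)
  have hM0 : 0 < M := hc.trans_le hMc
  set h : ℝ := c / M ^ 2 with hh
  have hh0 : 0 < h := by positivity
  have hhM : h * M ^ 2 = c := by rw [hh]; field_simp
  set q : ℝ := 1 - h * c with hq
  have hq0 : 0 ≤ q := by
    have : h * c ≤ h * M := mul_le_mul_of_nonneg_left hMc hh0.le
    have : h * M ≤ 1 := by
      rw [hh, div_mul_eq_mul_div, div_le_one (by positivity)]; nlinarith
    linarith
  have hstep : ∀ u w : V, ‖u‖ ≤ r → ‖w‖ ≤ r →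
      ‖(u + h • g u) - (w + h • g w)‖ ≤ √q * ‖u - w‖ := by
    intro u w hu hw
    refine abs_le_of_sq_le_sq' ?_ (by positivity) |>.2
    rw [mul_pow, Real.sq_sqrt hq0]
    have e : (u + h • g u) - (w + h • g w) = (u - w) + h • (g u - g w) := by
      rw [smul_sub]; abel
    rw [e, norm_add_sq_real, real_inner_smul_right, norm_smul, mul_pow, Real.norm_eq_abs, sq_abs]
    have h1 := hg u w hu hw
    have h2 : ‖g u - g w‖ ≤ M * ‖u - w‖ := (hlip u w hu hw).trans
      (mul_le_mul_of_nonneg_right ((le_abs_self K).trans (by linarith)) (norm_nonneg _))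
    have h3 : ‖g u - g w‖ ^ 2 ≤ M ^ 2 * ‖u - w‖ ^ 2 := by
      rw [← mul_pow]; exact pow_le_pow_left₀ (norm_nonneg _) h2 2
    have h4 : h ^ 2 * ‖g u - g w‖ ^ 2 ≤ h * c * ‖u - w‖ ^ 2 := by
      calc h ^ 2 * ‖g u - g w‖ ^ 2 ≤ h ^ 2 * (M ^ 2 * ‖u - w‖ ^ 2) := by gcongr
        _ = h * (h * M ^ 2) * ‖u - w‖ ^ 2 := by ring
        _ = _ := by rw [hhM]
    have h5 := mul_le_mul_of_nonneg_left h1 hh0.le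
    rw [hq]
    nlinarith
  have hq1 : √q < 1 := by
    rw [Real.sqrt_lt' one_pos]; have : 0 < h * c := by positivity
    linarith
  -- The inner retraction makes the map a contraction of the whole space while `g` is evaluated only
  -- in the ball; the outer one puts the fixed point in the ball.
  have hcon : ContractingWith (Real.toNNReal √q) (fun u : V =>
      radialRetraction r (radialRetraction r u + h • g (radialRetraction r u))) := by
    refine ⟨by rw [Real.toNNReal_lt_one]; exact hq1, LipschitzWith.of_dist_le_mul fun u w => ?_⟩
    rw [Real.coe_toNNReal _ (Real.sqrt_nonneg q), dist_eq_norm, dist_eq_norm]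
    refine (norm_radialRetraction_sub_le hr _ _).trans ?_
    refine (hstep _ _ (norm_radialRetraction_le hr u) (norm_radialRetraction_le hr w)).trans ?_
    exact mul_le_mul_of_nonneg_left (norm_radialRetraction_sub_le hr u w) (Real.sqrt_nonneg q)
  obtain ⟨u, hu⟩ : ∃ u : V,
      radialRetraction r (radialRetraction r u + h • g (radialRetraction r u)) = u :=
    ⟨_, hcon.fixedPoint_isFixedPt⟩
  have hur : ‖u‖ ≤ r := by rw [← hu]; exact norm_radialRetraction_le hr _
  rw [radialRetraction_of_norm_le hur] at hu
  refine ⟨u, hur, ?_⟩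
  rcases le_or_gt ‖u + h • g u‖ r with hin | hout
  · rw [radialRetraction_of_norm_le hin] at hu
    have : h • g u = 0 := by simpa using hu
    exact (smul_eq_zero.1 this).resolve_left hh0.ne'
  -- If the Euler step left the ball, `u` would lie on the sphere and `z` would be a multiple of `u`
  -- longer than `r`, so `g u` would point strictly outwards; dissipativity against `0` and `h0`
  -- forbid this.
  · exfalso
    have hpos := hr.trans_lt hout
    set z := u + h • g u with hz
    rw [radialRetraction_of_le_norm hout.le] at hu
    have hnu : ‖u‖ = r := by
      rw [← hu, norm_smul, Real.norm_of_nonneg (by positivity)]; field_simp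
    have hzu : z = (‖z‖ / r) • u := by
      rw [← hu, smul_smul]
      rw [show ‖z‖ / r * (r / ‖z‖) = 1 by field_simp, one_smul]
    have h1 : inner ℝ u z = ‖z‖ * r := by
      rw [hzu, real_inner_smul_right, real_inner_self_eq_norm_sq, hnu, ← hzu]; field_simp
    have h2 : inner ℝ u z = r ^ 2 + h * inner ℝ u (g u) := by
      rw [hz, inner_add_right, real_inner_smul_right, real_inner_self_eq_norm_sq, hnu]
    have h3 : inner ℝ u (g u) ≤ 0 := by
      have a := hg u 0 hur (by simpa using hr)
      rw [sub_zero, inner_sub_right, hnu] at a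
      have b := real_inner_le_norm u (g 0)
      rw [hnu] at b
      have := mul_le_mul_of_nonneg_left h0 hr
      nlinarith
    have h4 := mul_nonneg hh0.le (neg_nonneg.2 h3)
    nlinarith

end OneSidedLipschitz

/-! ### Transverse estimates, invariance of the tube, existence of equilibria. -/

section Transverse

variable {E V : Type*} [NormedAddCommGroup E] [NormedSpace ℝ E]
  [NormedAddCommGroup V] [InnerProductSpace ℝ V] {L : E →L[ℝ] V} {f : E → E} {D : Set E} {c : ℝ}

/-- A bound on the symmetric part of the transverse Jacobian along a convex set integrates to a
one-sided Lipschitz bound. -/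
lemma inner_map_sub_le_of_fderiv_le (hf : Differentiable ℝ f) (hD : Convex ℝ D)
    (h : ∀ x ∈ D, ∀ v, inner ℝ (L v) (L (fderiv ℝ f x v)) ≤ -c * ‖L v‖ ^ 2)
    {x y : E} (hx : x ∈ D) (hy : y ∈ D) :
    inner ℝ (L (x - y)) (L (f x) - L (f y)) ≤ -c * ‖L (x - y)‖ ^ 2 := by
  -- Pairing with a fixed vector makes the scalar mean value theorem available.
  have hd : ∀ t : ℝ, HasDerivAt (fun t : ℝ => inner ℝ (L (x - y)) (L (f (y + t • (x - y)))))
      (inner ℝ (L (x - y)) (L (fderiv ℝ f (y + t • (x - y)) (x - y)))) t := by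
    intro t
    have h1 : HasDerivAt (fun t : ℝ => y + t • (x - y)) (x - y) t := by
      simpa using ((hasDerivAt_id t).smul_const (x - y)).const_add y
    have h2 := (hf (y + t • (x - y))).hasFDerivAt.comp_hasDerivAt t h1
    have h3 := L.hasFDerivAt.comp_hasDerivAt t h2
    simpa using (hasDerivAt_const t (L (x - y))).inner ℝ h3
  obtain ⟨t, ht, hs⟩ := exists_hasDerivAt_eq_slope _ _ zero_lt_one
    (fun t _ => (hd t).continuousAt.continuousWithinAt) (fun t _ => hd t)
  have hmem : y + t • (x - y) ∈ D := hD.add_smul_sub_mem hy hx ⟨ht.1.le, ht.2.le⟩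
  have := h _ hmem (x - y)
  rw [hs] at this
  simpa [inner_sub_right] using this

/-- If the Jacobian maps the kernel of `L` to itself, then `L ∘ f` is constant along the kernel. -/
lemma map_eq_of_ker_invariant (hf : Differentiable ℝ f) (hD : Convex ℝ D)
    (h : ∀ x ∈ D, ∀ v, L v = 0 → L (fderiv ℝ f x v) = 0)
    {x y : E} (hx : x ∈ D) (hy : y ∈ D) (hxy : L (x - y) = 0) : L (f x) = L (f y) := by
  -- Pairing with the difference of the values itself turns a zero slope into a zero norm.
  have hd : ∀ t : ℝ, HasDerivAt
      (fun t : ℝ => inner ℝ (L (f x) - L (f y)) (L (f (y + t • (x - y)))))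
      (inner ℝ (L (f x) - L (f y)) (L (fderiv ℝ f (y + t • (x - y)) (x - y)))) t := by
    intro t
    have h1 : HasDerivAt (fun t : ℝ => y + t • (x - y)) (x - y) t := by
      simpa using ((hasDerivAt_id t).smul_const (x - y)).const_add y
    have h2 := (hf (y + t • (x - y))).hasFDerivAt.comp_hasDerivAt t h1
    have h3 := L.hasFDerivAt.comp_hasDerivAt t h2
    simpa using (hasDerivAt_const t (L (f x) - L (f y))).inner ℝ h3
  obtain ⟨t, ht, hs⟩ := exists_hasDerivAt_eq_slope _ _ zero_lt_one
    (fun t _ => (hd t).continuousAt.continuousWithinAt) (fun t _ => hd t)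
  have hmem : y + t • (x - y) ∈ D := hD.add_smul_sub_mem hy hx ⟨ht.1.le, ht.2.le⟩
  rw [h _ hmem _ hxy, inner_zero_right] at hs
  have : inner ℝ (L (f x) - L (f y)) (L (f x) - L (f y)) = 0 := by
    rw [inner_sub_right]
    simpa using hs.symm
  exact sub_eq_zero.1 (inner_self_eq_zero.1 this)

variable {r : ℝ} {xc : E}

/-- On the boundary of the tube the vector field does not point outwards. -/
lemma inner_map_nonpos_of_boundary
    (hmono : ∀ x ∈ D, ∀ y ∈ D, inner ℝ (L (x - y)) (L (f x) - L (f y)) ≤ -c * ‖L (x - y)‖ ^ 2)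
    (hker : ∀ x ∈ D, ∀ y ∈ D, L (x - y) = 0 → L (f x) = L (f y))
    (hxc : xc ∈ D) (hr : ‖L (f xc)‖ ≤ c * r) {y : E} (hy : y ∈ D) {w : V} {s : ℝ} (hs : 0 ≤ s)
    (hsr : s * ‖w‖ = r) (hyw : L (y - xc) = s • w) : inner ℝ w (L (f y)) ≤ 0 := by
  rcases hs.eq_or_lt with rfl | hs
  -- Here `r = 0`, so `L (f xc) = 0` and `y` lies in the fibre of `xc`; this is the only use of
  -- `hker`.
  · rw [zero_mul] at hsr
    rw [zero_smul] at hyw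
    rw [← hsr, mul_zero] at hr
    rw [hker y hy xc hxc hyw, norm_le_zero_iff.1 hr, inner_zero_right]
  · have h1 := hmono y hy xc hxc
    rw [hyw, norm_smul, Real.norm_of_nonneg hs.le, hsr, inner_sub_right, real_inner_smul_left] at h1
    have h2 := real_inner_le_norm (s • w) (L (f xc))
    rw [norm_smul, Real.norm_of_nonneg hs.le, hsr] at h2
    have h3 : 0 ≤ r := by rw [← hsr]; positivity
    have h4 := mul_le_mul_of_nonneg_left hr h3
    have h5 : s * inner ℝ w (L (f y)) ≤ 0 := by nlinarith
    exact nonpos_of_mul_nonpos_right h5 hs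

/-- A comparison principle: a function whose right derivative is at most `K (W - b)` wherever
`W > b` does not exceed the level `b` if it starts below it. -/
lemma le_of_deriv_right_le_mul_sub {W W' : ℝ → ℝ} {a t K b : ℝ}
    (hW : ContinuousOn W (Set.Icc a t))
    (hW' : ∀ s ∈ Set.Ico a t, HasDerivWithinAt W (W' s) (Set.Ici s) s) (ha : W a ≤ b)
    (h : ∀ s ∈ Set.Ico a t, b < W s → W' s ≤ K * (W s - b)) (hat : a ≤ t) : W t ≤ b := by
  -- The exponent `K + 1` makes the barrier grow strictly faster than `W` can at a contact point.
  have key : ∀ ε > 0, W t ≤ b + ε * Real.exp ((K + 1) * t) := by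
    intro ε hε
    have hB : ∀ s : ℝ, HasDerivAt (fun s => b + ε * Real.exp ((K + 1) * s))
        (ε * (Real.exp ((K + 1) * s) * (K + 1))) s := by
      intro s
      have := (((hasDerivAt_id s).const_mul (K + 1)).exp.const_mul ε).const_add b
      simpa using this
    refine image_le_of_deriv_right_lt_deriv_boundary' hW hW'
      (B := fun s => b + ε * Real.exp ((K + 1) * s)) ?_
      (fun s _ => (hB s).continuousAt.continuousWithinAt) (fun s _ => (hB s).hasDerivWithinAt) ?_
      (Set.right_mem_Icc.2 hat)
    · have : 0 < ε * Real.exp ((K + 1) * a) := by positivity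
      linarith
    · intro s hs heq
      have hp : 0 < ε * Real.exp ((K + 1) * s) := by positivity
      have := h s hs (by rw [heq]; linarith)
      rw [heq] at this
      nlinarith
  refine le_of_forall_pos_le_add fun δ hδ => ?_
  have := key (δ / Real.exp ((K + 1) * t)) (by positivity)
  rwa [div_mul_cancel₀ _ (Real.exp_pos _).ne'] at this

lemma hasDerivWithinAt_norm_sq_map_sub {x : ℝ → E} {v : E} {s : Set ℝ} {t : ℝ}
    (h : HasDerivWithinAt x v s t) :
    HasDerivWithinAt (fun t => ‖L (x t - xc)‖ ^ 2) (2 * inner ℝ (L (x t - xc)) (L v)) s t :=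
  ((L.hasFDerivAt (x := x t - xc)).comp_hasDerivWithinAt t (h.sub_const xc)).norm_sq

/-- Solutions of a semi-contracting system that start in the tube stay in it. -/
lemma norm_map_sub_le_of_isIntegralCurveOn {S : V →L[ℝ] E} (hLS : ∀ u, L (S u) = u)
    (hf : ContDiff ℝ 1 f)
    (hmono : ∀ x ∈ D, ∀ y ∈ D, inner ℝ (L (x - y)) (L (f x) - L (f y)) ≤ -c * ‖L (x - y)‖ ^ 2)
    (hker : ∀ x ∈ D, ∀ y ∈ D, L (x - y) = 0 → L (f x) = L (f y))
    (hxc : xc ∈ D) (hr0 : 0 ≤ r) (hr : ‖L (f xc)‖ ≤ c * r) (hD : ∀ x, ‖L (x - xc)‖ ≤ r → x ∈ D)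
    {T : ℝ} {x : ℝ → E} (hx : IsIntegralCurveOn x (fun _ => f) (Set.Ico 0 T))
    (h0 : ‖L (x 0 - xc)‖ ≤ r) {t : ℝ} (ht : t ∈ Set.Ico 0 T) : ‖L (x t - xc)‖ ≤ r := by
  have hxcont : ContinuousOn x (Set.Icc 0 t) := fun s hs =>
    ((hx s ⟨hs.1, hs.2.trans_lt ht.2⟩).continuousWithinAt).mono
      (fun a ha => ⟨ha.1, ha.2.trans_lt ht.2⟩)
  -- The tube may be unbounded along the kernel and `f` is only locally Lipschitz. The image of `Φ`
  -- is compact and contains both the trajectory and the boundary points it is compared with, so one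
  -- constant `K` serves.
  set Φ : ℝ × ℝ → E := fun q => x q.2 - q.1 • S (L (x q.2 - xc)) with hΦ
  have hΦc : ContinuousOn Φ (Set.Icc 0 1 ×ˢ Set.Icc 0 t) := by
    have h1 : ContinuousOn (fun q : ℝ × ℝ => x q.2) (Set.Icc 0 1 ×ˢ Set.Icc 0 t) :=
      hxcont.comp continuousOn_snd (fun q hq => hq.2)
    exact h1.sub (continuousOn_fst.smul
      (S.continuous.comp_continuousOn (L.continuous.comp_continuousOn (h1.sub continuousOn_const))))
  obtain ⟨K, hK⟩ := (hf.locallyLipschitz.locallyLipschitzOn).exists_lipschitzOnWith_of_compact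
    ((isCompact_Icc.prod isCompact_Icc).image_of_continuousOn hΦc)
  have hder : ∀ s ∈ Set.Ico 0 t, HasDerivWithinAt (fun s => ‖L (x s - xc)‖ ^ 2)
      (2 * inner ℝ (L (x s - xc)) (L (f (x s)))) (Set.Ici s) s := by
    intro s hs
    refine hasDerivWithinAt_norm_sq_map_sub ((hx s ⟨hs.1, hs.2.trans ht.2⟩).mono_of_mem_nhdsWithin ?_)
    exact mem_of_superset (Ico_mem_nhdsGE (hs.2.trans ht.2)) (Set.Ico_subset_Ico_left hs.1)
  have hW : ‖L (x t - xc)‖ ^ 2 ≤ r ^ 2 := by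
    refine le_of_deriv_right_le_mul_sub (W := fun s => ‖L (x s - xc)‖ ^ 2)
      (K := 2 * (‖L‖ * (K * ‖S‖))) ?_ hder
      (pow_le_pow_left₀ (norm_nonneg _) h0 2) ?_ ht.1
    · exact ((L.continuous.comp_continuousOn (hxcont.sub continuousOn_const)).norm).pow 2
    · intro s hs hlt
      have hst : s ∈ Set.Icc 0 t := ⟨hs.1, hs.2.le⟩
      set w := L (x s - xc) with hw
      have hrw : r < ‖w‖ := lt_of_pow_lt_pow_left₀ 2 (norm_nonneg _) hlt
      have hw0 : 0 < ‖w‖ := hr0.trans_lt hrw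
      have hσ1 : r / ‖w‖ ≤ 1 := (div_le_one hw0).2 hrw.le
      have hσ0 : 0 ≤ r / ‖w‖ := by positivity
      -- Outside the tube nothing is known about `f`, so `x s` is moved back along `S` to a boundary
      -- point, at a cost proportional to `‖w‖ - r`.
      set y := x s - (1 - r / ‖w‖) • S w with hy
      have hyw : L (y - xc) = (r / ‖w‖) • w := by
        have : y - xc = (x s - xc) - (1 - r / ‖w‖) • S w := by rw [hy]; abel
        rw [this, map_sub, map_smul, hLS, ← hw, sub_smul, one_smul]; abel
      have hyr : r / ‖w‖ * ‖w‖ = r := div_mul_cancel₀ _ hw0.ne'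
      have hyD : y ∈ D := hD y (by
        rw [hyw, norm_smul, Real.norm_of_nonneg hσ0, hyr])
      have hb := inner_map_nonpos_of_boundary hmono hker hxc hr hyD hσ0 hyr hyw
      have hxmem : x s ∈ Φ '' (Set.Icc 0 1 ×ˢ Set.Icc 0 t) :=
        ⟨(0, s), ⟨⟨le_rfl, zero_le_one⟩, hst⟩, by simp [hΦ]⟩
      have hymem : y ∈ Φ '' (Set.Icc 0 1 ×ˢ Set.Icc 0 t) :=
        ⟨(1 - r / ‖w‖, s), ⟨⟨by linarith, by linarith⟩, hst⟩, rfl⟩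
      have hlip : ‖f (x s) - f y‖ ≤ K * ‖x s - y‖ := hK.norm_sub_le hxmem hymem
      have hxy : ‖x s - y‖ ≤ ‖S‖ * (‖w‖ - r) := by
        have : x s - y = (1 - r / ‖w‖) • S w := by rw [hy]; abel
        rw [this, norm_smul, Real.norm_of_nonneg (by linarith)]
        calc (1 - r / ‖w‖) * ‖S w‖ ≤ (1 - r / ‖w‖) * (‖S‖ * ‖w‖) :=
              mul_le_mul_of_nonneg_left (S.le_opNorm w) (by linarith)
          _ = ‖S‖ * (‖w‖ - r / ‖w‖ * ‖w‖) := by ring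
          _ = _ := by rw [hyr]
      have hLf : ‖L (f (x s) - f y)‖ ≤ ‖L‖ * (K * ‖S‖) * (‖w‖ - r) := by
        calc ‖L (f (x s) - f y)‖ ≤ ‖L‖ * ‖f (x s) - f y‖ := L.le_opNorm _
          _ ≤ ‖L‖ * (K * (‖S‖ * (‖w‖ - r))) := by
              gcongr; exact hlip.trans (by gcongr)
          _ = _ := by ring
      have hin : inner ℝ w (L (f (x s))) ≤ ‖w‖ * (‖L‖ * (K * ‖S‖) * (‖w‖ - r)) := by
        have e : inner ℝ w (L (f (x s))) = inner ℝ w (L (f y)) + inner ℝ w (L (f (x s) - f y)) := by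
          rw [map_sub, inner_sub_right]; ring
        have := (real_inner_le_norm w (L (f (x s) - f y))).trans
          (mul_le_mul_of_nonneg_left hLf hw0.le)
        linarith
      have hM : 0 ≤ ‖L‖ * (K * ‖S‖) := by positivity
      -- The slack between `‖w‖ * (‖w‖ - r)` and `‖w‖ ^ 2 - r ^ 2`.
      have : 0 ≤ ‖L‖ * (K * ‖S‖) * (r * (‖w‖ - r)) :=
        mul_nonneg hM (mul_nonneg hr0 (by linarith))
      nlinarith
  exact (pow_le_pow_iff_left₀ (norm_nonneg _) hr0 two_ne_zero).1 hW

/-- A semi-contracting system has an equilibrium of the transverse dynamics in the tube of radius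
`‖L (f xc)‖ / c`. -/
lemma exists_map_eq_zero [FiniteDimensional ℝ V] {S : V →L[ℝ] E} (hLS : ∀ u, L (S u) = u)
    (hf : ContDiff ℝ 1 f) (hc : 0 < c)
    (hmono : ∀ x ∈ D, ∀ y ∈ D, inner ℝ (L (x - y)) (L (f x) - L (f y)) ≤ -c * ‖L (x - y)‖ ^ 2)
    (hD : ∀ x, ‖L (x - xc)‖ ≤ ‖L (f xc)‖ / c → x ∈ D) :
    ∃ xs, ‖L (xs - xc)‖ ≤ ‖L (f xc)‖ / c ∧ L (f xs) = 0 := by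
  have : CompleteSpace V := FiniteDimensional.complete ℝ V
  have hproper : ProperSpace V := FiniteDimensional.proper ℝ V
  set ρ := ‖L (f xc)‖ / c with hρ
  have hρ0 : 0 ≤ ρ := by positivity
  set g : V → V := fun u => L (f (xc + S u)) with hg
  have hgc : ContDiff ℝ 1 g :=
    L.contDiff.comp (hf.comp (contDiff_const.add S.contDiff))
  obtain ⟨K, hK⟩ := (hgc.locallyLipschitz.locallyLipschitzOn).exists_lipschitzOnWith_of_compact
    (isCompact_closedBall (0 : V) ρ)
  have hLx : ∀ u, L (xc + S u - xc) = u := fun u => by rw [add_sub_cancel_left, hLS]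
  have hmem : ∀ u, ‖u‖ ≤ ρ → xc + S u ∈ D := fun u hu => hD _ (by rwa [hLx])
  obtain ⟨u, hu, hgu⟩ := exists_zero_of_strongly_dissipative (g := g) (K := K) hc hρ0
    (fun u w hu hw => hK.norm_sub_le (by simpa using hu) (by simpa using hw))
    (fun u w hu hw => by
      have := hmono _ (hmem u hu) _ (hmem w hw)
      rwa [add_sub_add_left_eq_sub, ← map_sub S, hLS] at this)
    (by rw [hρ, mul_div_cancel₀ _ hc.ne']; simp [hg])
  exact ⟨xc + S u, by rwa [hLx], hgu⟩

end Transverse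

/-! ### Global solutions by truncating the field. -/

section GlobalExistence

variable {E : Type*} [NormedAddCommGroup E] [NormedSpace ℝ E] [CompleteSpace E]

/-- A bounded Lipschitz vector field has solutions on `[0, ∞)`. -/
lemma exists_isIntegralCurveOn_Ici {g : E → E} {K B : NNReal} (hg : LipschitzWith K g)
    (hB : ∀ x, ‖g x‖ ≤ B) (x₀ : E) :
    ∃ x : ℝ → E, x 0 = x₀ ∧ IsIntegralCurveOn x (fun _ => g) (Set.Ici 0) := by
  have hloc : ∀ n : ℕ, ∃ α : ℝ → E, α 0 = x₀ ∧
      ∀ t ∈ Set.Icc (0 : ℝ) n, HasDerivWithinAt α (g (α t)) (Set.Icc 0 n) t := by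
    intro n
    have hp : IsPicardLindelof (fun _ => g) (tmin := 0) (tmax := n)
        ⟨0, le_rfl, Nat.cast_nonneg n⟩ x₀ (B * n) 0 B K :=
      { lipschitzOnWith := fun t _ => hg.lipschitzOnWith
        continuousOn := fun x _ => continuousOn_const
        norm_le := fun t _ x _ => hB x
        mul_max_le := by simp }
    exact hp.exists_eq_forall_mem_Icc_hasDerivWithinAt₀
  choose α hα0 hα using hloc
  have hcont : ∀ m n : ℕ, m ≤ n → ContinuousOn (α n) (Set.Icc 0 m) := fun m n hmn t ht =>
    ((hα n t ⟨ht.1, ht.2.trans (by exact_mod_cast hmn)⟩).continuousWithinAt).mono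
      (Set.Icc_subset_Icc_right (by exact_mod_cast hmn))
  have hder : ∀ m n : ℕ, m ≤ n → ∀ t ∈ Set.Ico (0 : ℝ) m,
      HasDerivWithinAt (α n) (g (α n t)) (Set.Ici t) t := by
    intro m n hmn t ht
    have htn : t < n := ht.2.trans_le (by exact_mod_cast hmn)
    exact (hα n t ⟨ht.1, htn.le⟩).mono_of_mem_nhdsWithin
      (mem_of_superset (Icc_mem_nhdsGE htn) (Set.Icc_subset_Icc_left ht.1))
  have heq : ∀ m n : ℕ, m ≤ n → Set.EqOn (α m) (α n) (Set.Icc 0 m) := fun m n hmn =>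
    ODE_solution_unique_of_mem_Icc_right (v := fun _ => g) (s := fun _ => Set.univ) (K := K)
      (fun t _ => hg.lipschitzOnWith) (hcont m m le_rfl) (hder m m le_rfl) (fun _ _ => trivial)
      (hcont m n hmn) (hder m n hmn) (fun _ _ => trivial) (by rw [hα0, hα0])
  refine ⟨fun t => α ⌈t⌉₊ t, hα0 _, fun t ht => ?_⟩
  -- The extra `1` keeps `t` away from the right end, so that `[0, n]` is a neighbourhood of `t`
  -- within `[0, ∞)`.
  set n := ⌈t⌉₊ + 1 with hn
  have htn : t < n := (Nat.le_ceil t).trans_lt (by rw [hn]; exact_mod_cast Nat.lt_succ_self _)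
  have hagree : ∀ s ∈ Set.Icc (0 : ℝ) n, α ⌈s⌉₊ s = α n s := fun s hs =>
    heq _ _ (Nat.ceil_le.2 hs.2) ⟨hs.1, Nat.le_ceil s⟩
  have h1 := (hα n t ⟨ht, htn.le⟩).congr hagree (hagree t ⟨ht, htn.le⟩)
  rw [← hagree t ⟨ht, htn.le⟩] at h1
  refine h1.mono_of_mem_nhdsWithin ?_
  rw [← Set.Ici_inter_Iic]
  exact inter_mem_nhdsWithin _ (Iic_mem_nhds htn)

variable {V : Type*} [NormedAddCommGroup V] [InnerProductSpace ℝ V] [FiniteDimensional ℝ V]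
  {L : E →L[ℝ] V} {f : E → E} {D : Set E} {c r : ℝ} {xc : E}

/-- A semi-contracting system that is invariant under translations along the kernel has, from every
point of the tube, a solution on `[0, ∞)`. -/
lemma exists_isIntegralCurveOn_Ici_of_translation_invariant {S : V →L[ℝ] E}
    (hLS : ∀ u, L (S u) = u) (hf : ContDiff ℝ 1 f) (hinv : ∀ x v, L v = 0 → f (x + v) = f x)
    (hmono : ∀ x ∈ D, ∀ y ∈ D, inner ℝ (L (x - y)) (L (f x) - L (f y)) ≤ -c * ‖L (x - y)‖ ^ 2)
    (hxc : xc ∈ D) (hr0 : 0 ≤ r) (hr : ‖L (f xc)‖ ≤ c * r) (hD : ∀ x, ‖L (x - xc)‖ ≤ r → x ∈ D)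
    {x₀ : E} (hx₀ : ‖L (x₀ - xc)‖ ≤ r) :
    ∃ x : ℝ → E, x 0 = x₀ ∧ IsIntegralCurveOn x (fun _ => f) (Set.Ici 0) := by
  have hproper : ProperSpace V := FiniteDimensional.proper ℝ V
  set F : V → E := fun u => f (xc + S u) with hF
  have hFc : ContDiff ℝ 1 F := hf.comp (contDiff_const.add S.contDiff)
  obtain ⟨K, hK⟩ := (hFc.locallyLipschitz.locallyLipschitzOn).exists_lipschitzOnWith_of_compact
    (isCompact_closedBall (0 : V) r)
  obtain ⟨B, hB⟩ := (isCompact_closedBall (0 : V) r).exists_bound_of_continuousOn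
    hFc.continuous.continuousOn
  set g : E → E := fun x => F (radialRetraction r (L (x - xc))) with hgdef
  have hball : ∀ z : V, radialRetraction r z ∈ Metric.closedBall (0 : V) r := fun z => by
    simpa using norm_radialRetraction_le hr0 z
  have hfg : ∀ x, ‖L (x - xc)‖ ≤ r → g x = f x := by
    intro x hx
    have h1 : g x = f (xc + S (L (x - xc))) := by
      simp only [hgdef, hF, radialRetraction_of_norm_le hx]
    rw [h1, ← hinv _ (x - (xc + S (L (x - xc)))) (by
      rw [← sub_sub, map_sub L, hLS, sub_self]), add_sub_cancel]
  have hglip : LipschitzWith (K * (1 * ‖L‖₊)) g := by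
    refine LipschitzWith.of_dist_le_mul fun x y => ?_
    rw [dist_eq_norm, dist_eq_norm]
    have h1 := hK.norm_sub_le (hball (L (x - xc))) (hball (L (y - xc)))
    have h2 := norm_radialRetraction_sub_le hr0 (L (x - xc)) (L (y - xc))
    have h3 := L.le_opNorm (x - y)
    rw [← map_sub, sub_sub_sub_cancel_right] at h2
    calc ‖g x - g y‖ ≤ K * (‖L‖ * ‖x - y‖) :=
          h1.trans (mul_le_mul_of_nonneg_left (h2.trans h3) K.2)
      _ = _ := by push_cast; ring
  obtain ⟨x, hx0, hx⟩ := exists_isIntegralCurveOn_Ici (B := B.toNNReal) hglip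
    (fun x => (hB _ (hball _)).trans (Real.le_coe_toNNReal B)) x₀
  refine ⟨x, hx0, fun t ht => ?_⟩
  have hker : ∀ x ∈ D, ∀ y ∈ D, L (x - y) = 0 → L (f x) = L (f y) := fun x _ y _ h => by
    rw [← hinv y (x - y) h, add_sub_cancel]
  -- Outside the tube `g` takes the value of `f` at a boundary point, so the distance does not grow
  -- there and `K = 0` suffices.
  have hstay : ‖L (x t - xc)‖ ^ 2 ≤ r ^ 2 := by
    refine le_of_deriv_right_le_mul_sub (K := 0) (W := fun s => ‖L (x s - xc)‖ ^ 2)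
      (W' := fun s => 2 * inner ℝ (L (x s - xc)) (L (g (x s)))) (a := 0) ?_ ?_ ?_ ?_ ht
    · intro s hs
      exact (hasDerivWithinAt_norm_sq_map_sub (hx s hs.1)).continuousWithinAt.mono
        Set.Icc_subset_Ici_self
    · intro s hs
      exact hasDerivWithinAt_norm_sq_map_sub ((hx s hs.1).mono (Set.Ici_subset_Ici.2 hs.1))
    · rw [hx0]; exact pow_le_pow_left₀ (norm_nonneg _) hx₀ 2
    · intro s hs hlt
      have hrw : r < ‖L (x s - xc)‖ := lt_of_pow_lt_pow_left₀ 2 (norm_nonneg _) hlt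
      have hw0 : 0 < ‖L (x s - xc)‖ := hr0.trans_lt hrw
      have hyw : L (xc + S (radialRetraction r (L (x s - xc))) - xc)
          = (r / ‖L (x s - xc)‖) • L (x s - xc) := by
        rw [add_sub_cancel_left, hLS, radialRetraction_of_le_norm hrw.le]
      have := inner_map_nonpos_of_boundary hmono hker hxc hr
        (hD (xc + S (radialRetraction r (L (x s - xc)))) (by
          rw [add_sub_cancel_left, hLS]; exact norm_radialRetraction_le hr0 _))
        (by positivity) (div_mul_cancel₀ _ hw0.ne') hyw
      simp only [hgdef, hF]
      linarith
  have hle := (pow_le_pow_iff_left₀ (norm_nonneg _) hr0 two_ne_zero).1 hstay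
  have := hx t ht
  simp only [hfg _ hle] at this
  exact this

end GlobalExistence

/-! ### From the matrix measure to a quadratic form bound. -/

section MatrixMeasure

variable {ι : Type*} [Fintype ι] {V : Type*} [NormedAddCommGroup V] [InnerProductSpace ℝ V]
  {p : Seminorm ℝ (EuclideanSpace ℝ ι)} {L : EuclideanSpace ℝ ι →L[ℝ] V}
  {S : V →L[ℝ] EuclideanSpace ℝ ι}

/-- The point is boundedness of the set under the supremum: a vector orthogonal to the kernel is the
shortest in its coset, hence no longer than its representative `S (L u)`. -/
lemma le_inducedSeminorm (hp : ∀ x, p x = ‖L x‖) (hLS : ∀ u, L (S u) = u)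
    (A : EuclideanSpace ℝ ι →L[ℝ] EuclideanSpace ℝ ι) {v : EuclideanSpace ℝ ι}
    (hv : ∀ w, p w = 0 → inner ℝ v w = 0) (hv1 : p v ≤ 1) : p (A v) ≤ inducedSeminorm p A := by
  refine le_csSup ⟨‖L‖ * (‖A‖ * ‖S‖), ?_⟩ ⟨v, hv, hv1, rfl⟩
  rintro _ ⟨u, hu, hu1, rfl⟩
  have hnorm : ‖u‖ ≤ ‖S‖ := by
    have h1 := hu (u - S (L u)) (by rw [hp, map_sub, hLS, sub_self, norm_zero])
    rw [inner_sub_right, real_inner_self_eq_norm_sq, sub_eq_zero] at h1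
    have h2 : ‖S (L u)‖ ≤ ‖S‖ * 1 :=
      (S.le_opNorm _).trans (mul_le_mul_of_nonneg_left (by rwa [← hp]) (norm_nonneg S))
    have h3 := (real_inner_le_norm u (S (L u))).trans
      (mul_le_mul_of_nonneg_left h2 (norm_nonneg u))
    by_contra! h
    have := (norm_nonneg S).trans_lt h
    nlinarith
  rw [hp]
  exact (L.le_opNorm _).trans (by gcongr; exact (A.le_opNorm _).trans (by gcongr))

/-- The matrix measure bounds the symmetric part of the transverse dynamics from above. -/
lemma inner_map_le_of_hasMatrixMeasure (hp : ∀ x, p x = ‖L x‖) (hLS : ∀ u, L (S u) = u)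
    {A : EuclideanSpace ℝ ι →L[ℝ] EuclideanSpace ℝ ι} {m : ℝ} (hA : HasMatrixMeasure p A m)
    (hker : ∀ v, L v = 0 → L (A v) = 0) (v : EuclideanSpace ℝ ι) :
    inner ℝ (L v) (L (A v)) ≤ m * ‖L v‖ ^ 2 := by
  have key : ∀ u : EuclideanSpace ℝ ι, (∀ w, p w = 0 → inner ℝ u w = 0) → ‖L u‖ = 1 →
      inner ℝ (L u) (L (A u)) ≤ m := by
    intro u hu hu1
    -- Every quotient already dominates the inner product, since `‖L (u + h A u)‖ ≥ ⟪L u, L (u + h A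
    -- u)⟫ = 1 + h ⟪L u, L (A u)⟫`.
    refine ge_of_tendsto hA (eventually_mem_nhdsWithin.mono fun h hh => ?_)
    have hh0 : (0 : ℝ) < h := hh
    rw [le_div_iff₀ hh0]
    have h1 := le_inducedSeminorm hp hLS
      (ContinuousLinearMap.id ℝ (EuclideanSpace ℝ ι) + h • A) hu (by rw [hp, hu1])
    rw [hp] at h1
    have h2 := real_inner_le_norm (L u)
      (L ((ContinuousLinearMap.id ℝ (EuclideanSpace ℝ ι) + h • A) u))
    rw [hu1, one_mul] at h2
    simp only [add_apply, ContinuousLinearMap.id_apply,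
      smul_apply, map_add, map_smul, inner_add_right, real_inner_smul_right,
      real_inner_self_eq_norm_sq, hu1] at h1 h2
    linarith
  rcases eq_or_ne (L v) 0 with h0 | h0
  · simp [h0]
  set W : Submodule ℝ (EuclideanSpace ℝ ι) := LinearMap.ker L.toLinearMap with hW
  obtain ⟨y, hy, z, hz, hyz⟩ := W.exists_add_mem_mem_orthogonal v
  have hLy : L y = 0 := hy
  have hLv : L v = L z := by rw [hyz, map_add, hLy, zero_add]
  have hLAv : L (A v) = L (A z) := by rw [hyz, map_add, map_add, hker y hLy, zero_add]
  rw [hLv] at h0 ⊢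
  rw [hLAv]
  have hn : 0 < ‖L z‖ := norm_pos_iff.2 h0
  have h1 := key (‖L z‖⁻¹ • z) (fun w hw => by
    rw [real_inner_smul_left, real_inner_comm, (Submodule.mem_orthogonal W z).1 hz w
      (by rw [hp, norm_eq_zero] at hw; exact hw), mul_zero])
    (by rw [map_smul, norm_smul, norm_inv, norm_norm, inv_mul_cancel₀ hn.ne'])
  simp only [map_smul, real_inner_smul_left, real_inner_smul_right] at h1
  have h2 := mul_le_mul_of_nonneg_right h1 (sq_nonneg ‖L z‖)
  calc inner ℝ (L z) (L (A z))
      = ‖L z‖⁻¹ * (‖L z‖⁻¹ * inner ℝ (L z) (L (A z))) * ‖L z‖ ^ 2 := by field_simp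
    _ ≤ _ := h2

end MatrixMeasure

/-! ### Cosets of the kernel, tubes, and the factorization of the seminorm. -/

section Tubes

variable {ι : Type*} [Fintype ι] (p : Seminorm ℝ (EuclideanSpace ℝ ι))

lemma Seminorm.map_add_of_map_eq_zero {E : Type*} [AddCommGroup E] [Module ℝ E]
    (p : Seminorm ℝ E) (x : E) {v : E} (hv : p v = 0) : p (x + v) = p x := by
  refine le_antisymm ((map_add_le_add p x v).trans (by rw [hv, add_zero])) ?_
  have := map_add_le_add p (x + v) (-v)
  rwa [add_neg_cancel_right, map_neg_eq_map, hv, add_zero] at this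

lemma infDistCoset_eq (x y : EuclideanSpace ℝ ι) : infDistCoset p x y = p (x - y) := by
  have : Nonempty {v : EuclideanSpace ℝ ι // p v = 0} := ⟨⟨0, map_zero p⟩⟩
  have h : ∀ v : {v : EuclideanSpace ℝ ι // p v = 0}, p (x - (y + v)) = p (x - y) := fun v => by
    rw [← sub_sub, sub_eq_add_neg, p.map_add_of_map_eq_zero _ (by rw [map_neg_eq_map, v.2])]
  simp only [infDistCoset, h, ciInf_const]

lemma mem_tube_iff {x xc : EuclideanSpace ℝ ι} {r : ℝ} : x ∈ tube p xc r ↔ p (x - xc) ≤ r := by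
  rw [tube, Set.mem_ofPred_eq, infDistCoset_eq]

lemma mem_kerCoset_iff {x y : EuclideanSpace ℝ ι} : y ∈ kerCoset p x ↔ p (y - x) = 0 :=
  ⟨fun ⟨v, hv, hy⟩ => by rwa [hy, add_sub_cancel_left], fun h => ⟨y - x, h, by abel⟩⟩

lemma kerCoset_eq_of_map_sub_eq_zero {x y : EuclideanSpace ℝ ι} (h : p (y - x) = 0) :
    kerCoset p y = kerCoset p x := by
  ext z
  rw [mem_kerCoset_iff, mem_kerCoset_iff, ← sub_add_sub_cancel z y x,
    p.map_add_of_map_eq_zero _ h]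

/-- A weighted seminorm is the Euclidean norm of a surjective linear map with a linear section. -/
lemma exists_section_weightedSeminorm {κ : Type*} [DecidableEq ι] [Fintype κ] (R : Matrix κ ι ℝ) :
    ∃ (W : Submodule ℝ (EuclideanSpace ℝ κ)) (L : EuclideanSpace ℝ ι →L[ℝ] W)
      (S : W →L[ℝ] EuclideanSpace ℝ ι),
      (∀ x, weightedSeminorm R x = ‖L x‖) ∧ ∀ u, L (S u) = u := by
  set T := Matrix.toEuclideanLin R with hT
  obtain ⟨S, hS⟩ := T.rangeRestrict.exists_rightInverse_of_surjective T.range_rangeRestrict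
  exact ⟨LinearMap.range T, T.rangeRestrict.toContinuousLinearMap, S.toContinuousLinearMap,
    fun x => rfl, fun u => LinearMap.congr_fun hS u⟩

end Tubes

/-! ### The general semi-contracting system. -/

section SemiContraction

variable {ι : Type*} [Fintype ι] {V : Type*} [NormedAddCommGroup V] [InnerProductSpace ℝ V]
  {p : Seminorm ℝ (EuclideanSpace ℝ ι)} {L : EuclideanSpace ℝ ι →L[ℝ] V}
  {S : V →L[ℝ] EuclideanSpace ℝ ι} {f : EuclideanSpace ℝ ι → EuclideanSpace ℝ ι}
  {D : Set (EuclideanSpace ℝ ι)} {c r : ℝ} {xc : EuclideanSpace ℝ ι}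

lemma inner_map_sub_le_of_semiContractingOn (hp : ∀ x, p x = ‖L x‖) (hLS : ∀ u, L (S u) = u)
    (hf : ContDiff ℝ 1 f) (hD : Convex ℝ D) (hker : KernelInvariantOn p f D)
    (hcon : SemiContractingOn p f D c) :
    ∀ x ∈ D, ∀ y ∈ D, inner ℝ (L (x - y)) (L (f x) - L (f y)) ≤ -c * ‖L (x - y)‖ ^ 2 := by
  intro x hx y hy
  refine inner_map_sub_le_of_fderiv_le (hf.differentiable one_ne_zero) hD (fun z hz v => ?_) hx hy
  obtain ⟨m, hm, hmc⟩ := hcon z hz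
  refine (inner_map_le_of_hasMatrixMeasure hp hLS hm (fun v hv => ?_) v).trans
    (mul_le_mul_of_nonneg_right hmc (sq_nonneg _))
  have := hker z hz v (by rw [hp, hv, norm_zero])
  rwa [hp, norm_eq_zero] at this

lemma map_eq_of_kernelInvariantOn (hp : ∀ x, p x = ‖L x‖) (hf : ContDiff ℝ 1 f)
    (hD : Convex ℝ D) (hker : KernelInvariantOn p f D) :
    ∀ x ∈ D, ∀ y ∈ D, L (x - y) = 0 → L (f x) = L (f y) := by
  intro x hx y hy h
  refine map_eq_of_ker_invariant (hf.differentiable one_ne_zero) hD (fun z hz v hv => ?_) hx hy h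
  have := hker z hz v (by rw [hp, hv, norm_zero])
  rwa [hp, norm_eq_zero] at this

/-- A semi-contracting system has a forward-invariant tube that contains a transverse equilibrium
manifold, which is unique in the domain. -/
theorem forwardInvariant_tube_and_exists_isEquilibriumManifold {κ : Type*} [DecidableEq ι]
    [Fintype κ] (R : Matrix κ ι ℝ) (hf : ContDiff ℝ 1 f) (hD : Convex ℝ D)
    (hker : KernelInvariantOn (weightedSeminorm R) f D) (hc : 0 < c)
    (hcon : SemiContractingOn (weightedSeminorm R) f D c) (hxc : xc ∈ D)
    (hr : weightedSeminorm R (f xc) / c ≤ r) (htube : tube (weightedSeminorm R) xc r ⊆ D) :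
    ForwardInvariant f (tube (weightedSeminorm R) xc r) ∧
      ∃ xs : EuclideanSpace ℝ ι,
        kerCoset (weightedSeminorm R) xs ⊆ tube (weightedSeminorm R) xc r ∧
        IsEquilibriumManifold (weightedSeminorm R) f xs ∧
        infDistCoset (weightedSeminorm R) xc xs ≤ weightedSeminorm R (f xc) / c ∧
        ∀ ys ∈ D, weightedSeminorm R (f ys) = 0 →
          kerCoset (weightedSeminorm R) ys = kerCoset (weightedSeminorm R) xs := by
  obtain ⟨W, L, S, hp, hLS⟩ := exists_section_weightedSeminorm R
  generalize weightedSeminorm R = p at *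
  have hmono := inner_map_sub_le_of_semiContractingOn hp hLS hf hD hker hcon
  have hk := map_eq_of_kernelInvariantOn hp hf hD hker
  have hmem : ∀ x, ‖L (x - xc)‖ ≤ r → x ∈ D := fun x hx =>
    htube ((mem_tube_iff p).2 (by rwa [hp]))
  rw [hp] at hr
  have hr0 : 0 ≤ r := le_trans (by positivity) hr
  have hr' : ‖L (f xc)‖ ≤ c * r := by rwa [div_le_iff₀' hc] at hr
  refine ⟨fun T x hx h0 t ht => ?_, ?_⟩
  · rw [mem_tube_iff, hp] at h0 ⊢
    exact norm_map_sub_le_of_isIntegralCurveOn hLS hf hmono hk hxc hr0 hr' hmem hx h0 ht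
  -- Existence is applied at the smallest radius `‖L (f xc)‖ / c`, which yields the distance bound
  -- independently of `r`.
  · obtain ⟨xs, hxs, hzero⟩ := exists_map_eq_zero hLS hf hc hmono (fun x hx => hmem x (hx.trans hr))
    have hsub : kerCoset p xs ⊆ tube p xc r := fun y hy => by
      rw [mem_kerCoset_iff] at hy
      rw [mem_tube_iff, ← sub_add_sub_cancel' xs xc y, p.map_add_of_map_eq_zero _ hy, hp]
      exact hxs.trans hr
    have hxsD : xs ∈ D := hmem xs (hxs.trans hr)
    refine ⟨xs, hsub, fun y hy => ?_, ?_, fun ys hys h0 => ?_⟩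
    · have h1 := hy
      rw [mem_kerCoset_iff, hp, norm_eq_zero] at h1
      rw [hp, hk y (htube (hsub hy)) xs hxsD h1, hzero, norm_zero]
    · rw [infDistCoset_eq, map_sub_rev, hp, hp]; exact hxs
    · refine kerCoset_eq_of_map_sub_eq_zero p ?_
      rw [hp, norm_eq_zero] at h0
      have := hmono ys hys xs hxsD
      rw [h0, hzero, sub_zero, inner_zero_right] at this
      rw [hp]
      have h2 : ‖L (ys - xs)‖ ^ 2 ≤ 0 := by nlinarith [sq_nonneg ‖L (ys - xs)‖]
      exact pow_eq_zero_iff two_ne_zero |>.1 (le_antisymm h2 (sq_nonneg _))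

end SemiContraction

/-! ### Symmetry and regularity of the droop dynamics. -/

section Microgrid

variable {N : ℕ}

/-- The kernel is orthogonal to the row span, so it lies in the double orthogonal complement of the
line of constant vectors, which is that line. -/
lemma IsAngleProjection.apply_eq_of_mulVec_eq_zero {Rθ : Matrix (Fin (N - 1)) (Fin N) ℝ}
    (hR : IsAngleProjection Rθ) {u : Fin N → ℝ} (hu : Rθ.mulVec u = 0) (i k : Fin N) :
    u i = u k := by
  have h1 : (WithLp.toLp 2 u : EuclideanSpace ℝ (Fin N)) ∈
      (Submodule.span ℝ (Set.range fun a => (WithLp.toLp 2 (Rθ a) : EuclideanSpace ℝ (Fin N))))ᗮ := by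
    rw [Submodule.mem_orthogonal]
    intro w hw
    induction hw using Submodule.span_induction with
    | mem w hw =>
      obtain ⟨a, rfl⟩ := hw
      have := congrFun hu a
      simpa [EuclideanSpace.inner_eq_star_dotProduct, Matrix.mulVec, dotProduct_comm] using this
    | zero => exact inner_zero_left _
    | add x y _ _ hx hy => rw [inner_add_left, hx, hy, add_zero]
    | smul a x _ hx => rw [real_inner_smul_left, hx, mul_zero]
  rw [hR.2, Submodule.orthogonal_orthogonal, Submodule.mem_span_singleton] at h1
  obtain ⟨a, ha⟩ := h1
  have h2 : ∀ j, u j = a := fun j => by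
    have := congrArg (fun z : EuclideanSpace ℝ (Fin N) => z j) ha
    simpa using this.symm
  rw [h2 i, h2 k]

lemma gridProjection_seminorm_eq_zero {Rθ : Matrix (Fin (N - 1)) (Fin N) ℝ}
    (hR : IsAngleProjection Rθ) {v : GridState N} (hv : weightedSeminorm (gridProjection Rθ) v = 0) :
    (∀ i k, v (.inl i) = v (.inl k)) ∧ ∀ i, v (.inr i) = 0 := by
  have h0 : (gridProjection Rθ).mulVec v.ofLp = 0 := by
    have : ‖Matrix.toEuclideanLin (gridProjection Rθ) v‖ = 0 := hv
    rw [norm_eq_zero] at this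
    exact congrArg WithLp.ofLp this
  have h1 : v.ofLp = Sum.elim (fun i => v (.inl i)) (fun i => v (.inr i)) := by
    ext i; cases i <;> rfl
  rw [gridProjection, h1, Matrix.fromBlocks_mulVec] at h0
  constructor
  · refine hR.apply_eq_of_mulVec_eq_zero (u := fun i => v (.inl i)) ?_
    ext a
    have := congrFun h0 (.inl a)
    simpa [Function.comp_def] using this
  · intro i
    have := congrFun h0 (.inr i)
    simpa [Function.comp_def] using this

namespace DroopMicrogrid

variable (M : DroopMicrogrid N)

lemma vectorField_add_of_seminorm_eq_zero {Rθ : Matrix (Fin (N - 1)) (Fin N) ℝ}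
    (hR : IsAngleProjection Rθ) (x : GridState N) {v : GridState N}
    (hv : weightedSeminorm (gridProjection Rθ) v = 0) :
    M.vectorField (x + v) = M.vectorField x := by
  obtain ⟨h1, h2⟩ := gridProjection_seminorm_eq_zero hR hv
  have h3 : ∀ i k, (x + v) (.inl i) - (x + v) (.inl k) = x (.inl i) - x (.inl k) := fun i k => by
    rw [PiLp.add_apply, PiLp.add_apply, h1 i k]; ring
  have h4 : ∀ i, (x + v) (.inr i) = x (.inr i) := fun i => by
    rw [PiLp.add_apply, h2 i, add_zero]
  simp only [vectorField, activePower, reactivePower, h3, h4]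

lemma contDiff_vectorField : ContDiff ℝ 1 M.vectorField := by
  have hx : ∀ j, ContDiff ℝ 1 fun x : GridState N => x j := fun j => by fun_prop
  rw [contDiff_euclidean]
  rintro (i | i)
  · simp only [vectorField, activePower, Sum.elim_inl]
    fun_prop
  · simp only [vectorField, reactivePower, Sum.elim_inr]
    fun_prop

/-- The field is constant along kernel directions, so its Jacobian even annihilates them. -/
lemma kernelInvariantOn_vectorField {Rθ : Matrix (Fin (N - 1)) (Fin N) ℝ}
    (hR : IsAngleProjection Rθ) (D : Set (GridState N)) :
    KernelInvariantOn (weightedSeminorm (gridProjection Rθ)) M.vectorField D := by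
  intro x _ v hv
  have h1 : HasDerivAt (fun t : ℝ => x + t • v) v 0 := by
    simpa using ((hasDerivAt_id (0 : ℝ)).smul_const v).const_add x
  have h2 := (M.contDiff_vectorField.differentiable one_ne_zero
    (x + (0 : ℝ) • v)).hasFDerivAt.comp_hasDerivAt (0 : ℝ) h1
  have h3 : (M.vectorField ∘ fun t : ℝ => x + t • v) = fun _ => M.vectorField x := by
    ext1 t
    exact M.vectorField_add_of_seminorm_eq_zero hR x (by rw [map_smul_eq_mul, hv, mul_zero])
  rw [h3, zero_smul, add_zero] at h2
  rw [h2.unique (hasDerivAt_const _ _), map_zero]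

/-- From every point of the tube there is a solution of the droop dynamics on `[0, ∞)`. -/
lemma exists_isIntegralCurveOn_Ici {Rθ : Matrix (Fin (N - 1)) (Fin N) ℝ}
    (hR : IsAngleProjection Rθ) {D : Set (GridState N)} (hD : Convex ℝ D) {c r : ℝ} (hc : 0 < c)
    (hcon : SemiContractingOn (weightedSeminorm (gridProjection Rθ)) M.vectorField D c)
    {xc : GridState N} (hxc : xc ∈ D)
    (hr : weightedSeminorm (gridProjection Rθ) (M.vectorField xc) / c ≤ r)
    (htube : tube (weightedSeminorm (gridProjection Rθ)) xc r ⊆ D) {x₀ : GridState N}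
    (hx₀ : x₀ ∈ tube (weightedSeminorm (gridProjection Rθ)) xc r) :
    ∃ x : ℝ → GridState N, x 0 = x₀ ∧
      IsIntegralCurveOn x (fun _ => M.vectorField) (Set.Ici 0) := by
  have hinv := fun x v => M.vectorField_add_of_seminorm_eq_zero hR x (v := v)
  have hker := M.kernelInvariantOn_vectorField hR D
  obtain ⟨W, L, S, hp, hLS⟩ := exists_section_weightedSeminorm (gridProjection Rθ)
  generalize weightedSeminorm (gridProjection Rθ) = p at *
  have hmono := inner_map_sub_le_of_semiContractingOn hp hLS M.contDiff_vectorField hD hker hcon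
  rw [hp] at hr
  rw [mem_tube_iff, hp] at hx₀
  exact _root_.exists_isIntegralCurveOn_Ici_of_translation_invariant hLS M.contDiff_vectorField
    (fun x v hv => hinv x v (by rw [hp, hv, norm_zero])) hmono hxc (le_trans (by positivity) hr)
    (by rwa [div_le_iff₀' hc] at hr) (fun x hx => htube ((mem_tube_iff p).2 (by rwa [hp]))) hx₀

end DroopMicrogrid

end Microgrid

theorem corollary2 :
    -- general autonomous systems
    (∀ {ι κ : Type*} [Fintype ι] [DecidableEq ι] [Fintype κ] (R : Matrix κ ι ℝ)
      (f : EuclideanSpace ℝ ι → EuclideanSpace ℝ ι), ContDiff ℝ 1 f →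
      ∀ (D : Set (EuclideanSpace ℝ ι)), Convex ℝ D →
      KernelInvariantOn (weightedSeminorm R) f D →
      ∀ c : ℝ, 0 < c → SemiContractingOn (weightedSeminorm R) f D c →
      ∀ xc ∈ D, ∀ r : ℝ, weightedSeminorm R (f xc) / c ≤ r →
      tube (weightedSeminorm R) xc r ⊆ D →
        ForwardInvariant f (tube (weightedSeminorm R) xc r) ∧
        ∃ xs : EuclideanSpace ℝ ι,
          kerCoset (weightedSeminorm R) xs ⊆ tube (weightedSeminorm R) xc r ∧
          IsEquilibriumManifold (weightedSeminorm R) f xs ∧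
          infDistCoset (weightedSeminorm R) xc xs ≤ weightedSeminorm R (f xc) / c ∧
          ∀ ys ∈ D, weightedSeminorm R (f ys) = 0 →
            kerCoset (weightedSeminorm R) ys = kerCoset (weightedSeminorm R) xs) ∧
    -- droop-controlled microgrids, where regularity and kernel invariance are not assumed
    (∀ {N : ℕ} (M : DroopMicrogrid N) (Rθ : Matrix (Fin (N - 1)) (Fin N) ℝ),
      IsAngleProjection Rθ →
      ∀ (D : Set (GridState N)), Convex ℝ D →
      ∀ c : ℝ, 0 < c →
      SemiContractingOn (weightedSeminorm (gridProjection Rθ)) M.vectorField D c →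
      ∀ xc ∈ D, ∀ r : ℝ, weightedSeminorm (gridProjection Rθ) (M.vectorField xc) / c ≤ r →
      tube (weightedSeminorm (gridProjection Rθ)) xc r ⊆ D →
        ForwardInvariant M.vectorField (tube (weightedSeminorm (gridProjection Rθ)) xc r) ∧
        (∀ x₀ ∈ tube (weightedSeminorm (gridProjection Rθ)) xc r, ∃ x : ℝ → GridState N,
          x 0 = x₀ ∧ IsIntegralCurveOn x (fun _ => M.vectorField) (Set.Ici 0)) ∧
        ∃ xs : GridState N,
          kerCoset (weightedSeminorm (gridProjection Rθ)) xs ⊆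
            tube (weightedSeminorm (gridProjection Rθ)) xc r ∧
          IsEquilibriumManifold (weightedSeminorm (gridProjection Rθ)) M.vectorField xs ∧
          infDistCoset (weightedSeminorm (gridProjection Rθ)) xc xs ≤
            weightedSeminorm (gridProjection Rθ) (M.vectorField xc) / c ∧
          ∀ ys ∈ D, weightedSeminorm (gridProjection Rθ) (M.vectorField ys) = 0 →
            kerCoset (weightedSeminorm (gridProjection Rθ)) ys =
              kerCoset (weightedSeminorm (gridProjection Rθ)) xs) := by
  refine ⟨?_, ?_⟩
  · intro ι κ _ _ _ R f hf D hD hker c hc hcon xc hxc r hr htube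
    exact forwardInvariant_tube_and_exists_isEquilibriumManifold R hf hD hker hc hcon hxc hr htube
  · intro N M Rθ hR D hD c hc hcon xc hxc r hr htube
    obtain ⟨hinv, hequi⟩ := forwardInvariant_tube_and_exists_isEquilibriumManifold
      (gridProjection Rθ) M.contDiff_vectorField hD (M.kernelInvariantOn_vectorField hR D) hc hcon
      hxc hr htube
    exact ⟨hinv, fun x₀ hx₀ => M.exists_isIntegralCurveOn_Ici hR hD hc hcon hxc hr htube hx₀, hequi⟩
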